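/- All graphs are finite and undirected. A (not necessarily injective) sum labeling of a graph $G$ without loops is a function $\ell:V(G)\to\{1,2,3,\dots\}$ such that any two distinct vertices $u,v$ are adjacent if and only if $\ell(u)+\ell(v)=\ell(w)$ for some $w\in V(G)$; it is minimal if $\ell(w)=1$ for some $w\in V(G)$. A non-injective sum graph is a graph without loops that has a (not necessarily injective) sum labeling. For $n\ge 2$ let $A_n$ be the graph with loops whose vertex set is $S_n=\{2,3,\dots,n\}\cup\{n+2\}$, where (not necessarily distinct) vertices $i,j$ are adjacent if and only if $i+j\in S_n$. Let $\mathcal C(A_n)$ be the class of all graphs, up to isomorphism, obtained from $A_n$ by choosing, independently for each vertex $v$ with a loop, an integer $k_v\ge 2$, and replacing $v$ (with its loop) by a clique on $k_v$ vertices, each of which is joined to all the neighbours of $v$ other than $v$ (respectively, to all the vertices replacing such a neighbour). Theorem. For every $n\ge 39$, every graph in $\mathcal C(A_n)$ is a non-injective sum graph that has no minimal labeling. In particular, there is an infinite family $(F_n)_{n\ge 39}$ of pairwise non-isomorphic non-injective sum graphs (without loops), with $F_n\in\mathcal C(A_n)$, that have no minimal labeling. -/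

import Mathlib

namespace SumGraphs

universe u v

/-- A (not necessarily injective) sum labeling of a graph without loops: labels are positive
integers, and two distinct vertices are adjacent iff the sum of their labels is a label. -/
structure IsSumLabeling {V : Type u} (G : SimpleGraph V) (l : V → ℕ) : Prop where
  pos : ∀ x, 0 < l x
  adj_iff : ∀ x y, x ≠ y → (G.Adj x y ↔ ∃ z, l z = l x + l y)

/-- A non-injective sum graph (without loops): one with a not necessarily injective
sum labeling. -/
def IsNonInjSumGraph {V : Type u} (G : SimpleGraph V) : Prop :=
  ∃ l : V → ℕ, IsSumLabeling G l

/-- A minimal labeling is a sum labeling that uses the label `1`. -/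
def IsMinimalLabeling {V : Type u} (G : SimpleGraph V) (l : V → ℕ) : Prop :=
  IsSumLabeling G l ∧ ∃ x, l x = 1

/-- An undirected graph in which vertices may carry loops. -/
structure LoopGraph (V : Type u) where
  Adj : V → V → Prop
  symm : ∀ x y, Adj x y → Adj y x

/-- The sum graph with loops induced by a finite set `S` of natural numbers. -/
def inducedLoopGraph (S : Finset ℕ) : LoopGraph {i : ℕ // i ∈ S} where
  Adj i j := (i : ℕ) + (j : ℕ) ∈ S
  symm i j h := by rw [Nat.add_comm]; exact h

/-- The set `{2, 3, …, n, n + 2}`. -/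
def setA (n : ℕ) : Finset ℕ := insert (n + 2) (Finset.Icc 2 n)

/-- The graph `A_n`. -/
def graphA (n : ℕ) : LoopGraph {i : ℕ // i ∈ setA n} := inducedLoopGraph (setA n)

/-- Admissible clique sizes: at least `2` at each looped vertex; a vertex without a loop is
kept as a single vertex. -/
def IsCliqueSize {V : Type u} (G : LoopGraph V) (k : V → ℕ) : Prop :=
  ∀ x, (G.Adj x x → 2 ≤ k x) ∧ (¬ G.Adj x x → k x = 1)

/-- Replace each vertex `x` by `k x` copies. Distinct copies of `x` are adjacent iff `x` has a
loop, and copies of distinct `x`, `y` are adjacent iff `x`, `y` are. -/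
def blowUp {V : Type u} (G : LoopGraph V) (k : V → ℕ) : SimpleGraph (Σ x : V, Fin (k x)) where
  Adj a b := a ≠ b ∧ G.Adj a.1 b.1
  symm := ⟨fun _ _ h => ⟨h.1.symm, G.symm _ _ h.2⟩⟩
  loopless := ⟨fun _ h => h.1 rfl⟩

/-- `H` belongs to `C(G)`: up to isomorphism, `H` arises from `G` by replacing each looped
vertex by a clique of some size at least `2`, chosen independently for each vertex. -/
def InC {V : Type u} {W : Type v} (G : LoopGraph V) (H : SimpleGraph W) : Prop :=
  ∃ k : V → ℕ, IsCliqueSize G k ∧ Nonempty (H ≃g blowUp G k)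

end SumGraphs

/-! Labeling each vertex by its class in $A_n$ gives a sum labeling. For the absence of a minimal
one, vertices with equal labels must lie in the same class, because classes have different
neighbourhoods; so a labeling becomes a finite set `L` of labels with a class map `f`, and `g` picks
one label of each class.

Adding labels of distinct neighbouring classes to a label `b` gives distinct labels above `b`, so a
class with many neighbours cannot occur near the top. The largest label belongs to the isolated
class `n + 2`, and each of the next few belongs to some `n + 2 - j` with `j` in a short range
(`exists_isTop_cons`). Vertices `i` and `n + 2 - j` are adjacent iff `i = j` or `i + 2 ≤ j`, so
every candidate order of the top labels yields a small linear system in the `g i` and the offsets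
from the top. A case search (`OffsetOrder.exists_chain`) leaves two orders.

One of them omits `n` and is refuted by locating the label of `n`. In the other, `g 2 = 2r` and `g 3
= 3r`, and the labels of `n`, `n - 1`, `n - 2` lie `2r`, `3r`, `4r` below the top. Repeatedly adding
`g 2` to any label ends at the label of `n + 2` or of `n - 1`. Starting from `g 2`, this shows that
`r` divides the top label; starting from a label `1`, that `r = 1`. Then adding `1` to the labels of
`n - 2` and `n - 1` gives the next labels, so the class of `1` is adjacent to both `n - 1` and `n -
2`; but these two have no common neighbour. -/

namespace SumGraphs

/-- The offsets `x j` of the labels of the vertices `n + 2 - j` below the largest label, read from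
the top: the list gives the indices `j` in order of decreasing `x j`, the index `0` being implicit,
and `x j` is a sum of `a i` and a smaller offset iff `i` and `n + 2 - j` are adjacent. -/
def OffsetOrder (x a : ℕ → ℕ) : List ℕ → Prop
  | [] => x 0 = 0 ∧ [a 2, a 3, a 4, a 5, a 6, a 7, a 8].Nodup
  | j :: J => OffsetOrder x a J ∧ (∀ t ∈ 0 :: J, x t < x j) ∧
      ∀ i ∈ [2, 3, 4, 5, 6, 7, 8], ((i + 2 ≤ j ∨ i = j) ↔ ∃ t ∈ 0 :: J, x j = a i + x t)

/-- The part of `OffsetOrder` on pairs that are not adjacent. -/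
def OffsetNonadj (x a : ℕ → ℕ) : List ℕ → Prop
  | [] => [a 2, a 3, a 4, a 5, a 6, a 7].Nodup
  | j :: J => OffsetNonadj x a J ∧
      ∀ i ∈ [2, 3, 4, 5, 6], ¬ (i + 2 ≤ j ∨ i = j) → ∀ t ∈ 0 :: J, x j ≠ a i + x t

/-! ### Linear systems for the offsets of the top labels -/

section offsets

variable {x a : ℕ → ℕ}

theorem OffsetOrder.nonadj : ∀ {J : List ℕ}, OffsetOrder x a J → OffsetNonadj x a J
  | [], h => by have := h.2; simp [OffsetNonadj] at this ⊢; tauto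
  | j :: J, h => ⟨h.1.nonadj, fun i hi hij t ht e =>
      hij ((h.2.2 i (by simp at hi ⊢; tauto)).2 ⟨t, ht, e⟩)⟩

theorem OffsetOrder.zero : ∀ {J : List ℕ}, OffsetOrder x a J → x 0 = 0
  | [], h => h.1
  | _ :: _, h => h.1.zero

theorem OffsetOrder.pairwise : ∀ {J : List ℕ}, OffsetOrder x a J →
    (J ++ [0]).Pairwise fun s t => x t < x s
  | [], _ => by simp
  | j :: J, h => List.pairwise_cons.2
      ⟨fun t ht => h.2.1 t (by simp at ht ⊢; tauto), h.1.pairwise⟩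

theorem OffsetOrder.facts {j : ℕ} {J : List ℕ} (h : OffsetOrder x a (j :: J)) :
    x 0 = 0 ∧ ((j :: J) ++ [0]).Pairwise (fun s t => x t < x s) ∧ OffsetNonadj x a (j :: J) ∧
      ∀ i ∈ [2, 3, 4, 5, 6, 7, 8], ((i + 2 ≤ j ∨ i = j) ↔ ∃ t ∈ 0 :: J, x j = a i + x t) :=
  ⟨h.zero, h.pairwise, h.nonadj, h.2.2⟩

/-- The names of these lemmas read the indices from the top label downwards, opposite to the list.
Each lemma solves a finite system: an adjacent `i` forces `x j = a i + x t` for some larger label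
`t`, a nonadjacent `i` forbids all such equations, and the `a i` are distinct. -/
theorem offsets_two (h : OffsetOrder x a [2]) : x 2 = a 2 := by
  obtain ⟨h0, hp, hn, h⟩ := h.facts
  simp [OffsetNonadj, h0] at h hp hn
  grind (splits := 30)

theorem offsets_three (h : OffsetOrder x a [3]) : x 3 = a 3 := by
  obtain ⟨h0, hp, hn, h⟩ := h.facts
  simp [OffsetNonadj, h0] at h hp hn
  grind (splits := 30)

theorem offsets_two_three (h : OffsetOrder x a [3, 2]) : x 3 = a 3 ∨ x 3 = a 3 + a 2 := by
  have := offsets_two h.1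
  obtain ⟨h0, hp, hn, h⟩ := h.facts
  simp [OffsetNonadj, h0] at h hp hn
  grind (splits := 30)

theorem offsets_two_four (h : OffsetOrder x a [4, 2]) : x 4 = 2 * a 2 ∧ a 4 = 2 * a 2 := by
  have := offsets_two h.1
  obtain ⟨h0, hp, hn, h⟩ := h.facts
  simp [OffsetNonadj, h0] at h hp hn
  grind (splits := 30)

theorem offsets_three_two (h : OffsetOrder x a [2, 3]) : x 2 = a 2 ∨ x 2 = a 2 + a 3 := by
  have := offsets_three h.1
  obtain ⟨h0, hp, hn, h⟩ := h.facts
  simp [OffsetNonadj, h0] at h hp hn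
  grind (splits := 30)

theorem offsets_three_four (h : OffsetOrder x a [4, 3]) :
    x 4 = a 2 ∧ x 4 = a 4 + a 3 ∨ x 4 = a 4 ∧ x 4 = a 2 + a 3 := by
  have := offsets_three h.1
  obtain ⟨h0, hp, hn, h⟩ := h.facts
  simp [OffsetNonadj, h0] at h hp hn
  grind (splits := 30)

theorem offsets_two_three_four (h : OffsetOrder x a [4, 3, 2]) :
    x 4 = 2 * a 2 ∧ (x 4 = a 4 ∨ x 4 = a 4 + x 3) ∨
      x 3 = a 3 + a 2 ∧ x 4 = x 3 + a 2 ∧ x 4 = a 4 := by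
  have := offsets_two h.1.1
  have := offsets_two_three h.1
  obtain ⟨h0, hp, hn, h⟩ := h.facts
  simp [OffsetNonadj, h0] at h hp hn
  grind (splits := 30)

theorem offsets_two_three_five (h : OffsetOrder x a [5, 3, 2]) :
    x 5 = a 5 ∧ (x 3 = a 3 ∧ x 5 = x 3 + a 2 ∨ a 2 = 2 * a 3 ∧ x 3 = 3 * a 3 ∧ x 5 = 4 * a 3) := by
  have := offsets_two h.1.1
  have := offsets_two_three h.1
  obtain ⟨h0, hp, hn, h⟩ := h.facts
  simp [OffsetNonadj, h0] at h hp hn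
  grind (splits := 30)

theorem offsets_two_three_four_five (h : OffsetOrder x a [5, 4, 3, 2]) :
    x 4 = 2 * a 2 ∧ x 5 = x 3 + a 2 ∧ x 5 = a 5 := by
  have := offsets_two h.1.1.1
  have := offsets_two_three h.1.1
  have := offsets_two_three_four h.1
  obtain ⟨h0, hp, hn, h⟩ := h.facts
  simp [OffsetNonadj, h0] at h hp hn
  grind (splits := 30)

theorem offsets_two_three_four_six (h : OffsetOrder x a [6, 4, 3, 2]) :
    2 * a 3 = 3 * a 2 ∧ x 3 = a 3 ∧ x 4 = 2 * a 2 ∧ a 4 = 2 * a 2 ∧ x 6 = 3 * a 2 ∧ a 6 = 3 * a 2 ∨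
      x 3 = 3 * a 2 ∧ a 3 = 2 * a 2 ∧ x 4 = 4 * a 2 ∧ a 4 = 4 * a 2 ∧ x 6 = 5 * a 2 ∧
        a 6 = 5 * a 2 := by
  have h2 := offsets_two h.1.1.1
  have h3 := offsets_two_three h.1.1
  have h4 := offsets_two_three_four h.1
  obtain ⟨h0, hp, hn, h⟩ := h.facts
  simp [OffsetNonadj, h0] at h hp hn
  -- `s2` says which larger label is reached by adding `a 2`; splitting on it first keeps the search
  -- small.
  obtain ⟨s2, h⟩ := h
  rcases s2 with s2 | s2 | s2 | s2 <;>
  rcases h4 with ⟨h4, h4' | h4'⟩ | ⟨h3', h4, h4'⟩ <;>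
  rcases h3 with h3 | h3 <;>
  grind (splits := 20)

theorem offsets_two_four_three (h : OffsetOrder x a [3, 4, 2]) :
    x 3 = a 3 ∨ x 3 = a 3 + a 2 ∨ x 3 = a 3 + 2 * a 2 := by
  have := offsets_two h.1.1
  have := offsets_two_four h.1
  obtain ⟨h0, hp, hn, h⟩ := h.facts
  simp [OffsetNonadj, h0] at h hp hn
  grind (splits := 30)

theorem offsets_two_four_three_five (h : OffsetOrder x a [5, 3, 4, 2]) :
    (x 3 = a 3 ∨ x 3 = a 3 + a 2) ∧ x 5 = x 3 + a 2 ∧ x 5 = a 5 := by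
  have := offsets_two h.1.1.1
  have := offsets_two_four h.1.1
  have := offsets_two_four_three h.1
  obtain ⟨h0, hp, hn, h⟩ := h.facts
  simp [OffsetNonadj, h0] at h hp hn
  grind (splits := 30)

theorem offsets_two_four_three_six (h : OffsetOrder x a [6, 3, 4, 2]) :
    a 2 = 2 * a 3 ∧ x 3 = 5 * a 3 ∧ x 6 = 6 * a 3 ∧ a 6 = 6 * a 3 := by
  have := offsets_two h.1.1.1
  have := offsets_two_four h.1.1
  have := offsets_two_four_three h.1
  obtain ⟨h0, hp, hn, h⟩ := h.facts
  simp [OffsetNonadj, h0] at h hp hn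
  grind (splits := 30)

theorem offsets_three_two_four (h : OffsetOrder x a [4, 2, 3]) :
    x 4 = x 2 + a 2 ∧ (x 2 = a 2 ∨ x 2 = a 2 + a 3) ∧ (x 4 = a 4 ∨ x 4 = a 4 + a 3) := by
  have := offsets_three h.1.1
  have := offsets_three_two h.1
  obtain ⟨h0, hp, hn, h⟩ := h.facts
  simp [OffsetNonadj, h0] at h hp hn
  grind (splits := 30)

theorem offsets_three_two_five (h : OffsetOrder x a [5, 2, 3]) :
    x 2 = a 2 ∧ x 5 = a 2 + a 3 ∧ x 5 = a 5 ∨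
      a 3 = 2 * a 2 ∧ x 2 = 3 * a 2 ∧ x 5 = 4 * a 2 ∧ a 5 = 4 * a 2 := by
  have := offsets_three h.1.1
  have := offsets_three_two h.1
  obtain ⟨h0, hp, hn, h⟩ := h.facts
  simp [OffsetNonadj, h0] at h hp hn
  grind (splits := 30)

theorem offsets_three_four_two (h : OffsetOrder x a [2, 4, 3]) : x 2 = x 4 + a 2 := by
  have := offsets_three h.1.1
  have := offsets_three_four h.1
  obtain ⟨h0, hp, hn, h⟩ := h.facts
  simp [OffsetNonadj, h0] at h hp hn
  grind (splits := 30)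

theorem offsets_three_four_five (h : OffsetOrder x a [5, 4, 3]) :
    x 4 = a 2 ∧ x 4 = a 4 + a 3 ∧ x 5 = a 2 + a 3 ∧ x 5 = a 5 ∨
      a 3 = 2 * a 2 ∧ a 4 = 3 * a 2 ∧ x 4 = 3 * a 2 ∧ x 5 = 4 * a 2 ∧ a 5 = 4 * a 2 := by
  have := offsets_three h.1.1
  have := offsets_three_four h.1
  obtain ⟨h0, hp, hn, h⟩ := h.facts
  simp [OffsetNonadj, h0] at h hp hn
  grind (splits := 30)

theorem offsets_three_two_four_five (h : OffsetOrder x a [5, 4, 2, 3]) :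
    a 3 = 3 * a 2 ∧ x 2 = 4 * a 2 ∧ x 4 = 5 * a 2 ∧ a 4 = 5 * a 2 ∧ x 5 = 6 * a 2 ∧
      a 5 = 6 * a 2 := by
  have := offsets_three h.1.1.1
  have := offsets_three_two_four h.1
  obtain ⟨h0, hp, hn, h⟩ := h.facts
  simp [OffsetNonadj, h0] at h hp hn
  grind (splits := 30)

theorem offsets_three_two_four_six (h : OffsetOrder x a [6, 4, 2, 3]) :
    a 3 = 3 * a 2 ∧ x 2 = 4 * a 2 ∧ x 4 = 5 * a 2 ∧ a 4 = 2 * a 2 ∧ x 6 = 6 * a 2 ∧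
      a 6 = 6 * a 2 := by
  have := offsets_three h.1.1.1
  have := offsets_three_two_four h.1
  obtain ⟨h0, hp, hn, h⟩ := h.facts
  simp [OffsetNonadj, h0] at h hp hn
  grind (splits := 30)

theorem offsets_three_two_five_four (h : OffsetOrder x a [4, 5, 2, 3]) :
    x 2 = a 2 ∧ x 5 = a 2 + a 3 ∧ x 5 = a 5 ∧ x 4 = 2 * a 2 ∧ (x 4 = a 4 ∨ x 4 = a 4 + a 3) := by
  have := offsets_three h.1.1.1
  have := offsets_three_two_five h.1
  obtain ⟨h0, hp, hn, h⟩ := h.facts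
  simp [OffsetNonadj, h0] at h hp hn
  grind (splits := 30)

theorem offsets_three_four_two_five (h : OffsetOrder x a [5, 2, 4, 3]) :
    a 3 = 3 * a 2 ∧ a 4 = 4 * a 2 ∧ x 4 = 4 * a 2 ∧ x 2 = 5 * a 2 ∧ x 5 = 6 * a 2 ∧
      a 5 = 6 * a 2 := by
  have := offsets_three h.1.1.1
  have := offsets_three_four h.1.1
  have := offsets_three_four_two h.1
  obtain ⟨h0, hp, hn, h⟩ := h.facts
  simp [OffsetNonadj, h0] at h hp hn
  grind (splits := 30)

/-- This is the order of the natural labeling; the ratio `a 2 : a 3 = 2 : 3` is what remains of it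
up to scaling. -/
theorem offsets_two_three_four_five_six (h : OffsetOrder x a [6, 5, 4, 3, 2]) :
    2 * a 3 = 3 * a 2 ∧ x 3 = a 3 := by
  have := offsets_two h.1.1.1.1
  have := offsets_two_three h.1.1.1
  have := offsets_two_three_four h.1.1
  have := offsets_two_three_four_five h.1
  obtain ⟨h0, hp, hn, h⟩ := h.facts
  simp [OffsetNonadj, h0] at h hp hn
  obtain ⟨s2, h⟩ := h
  rcases s2 with s2 | s2 | s2 | s2 | s2 <;>
  grind (splits := 20)

theorem offsets_two_three_four_five_seven (h : OffsetOrder x a [7, 5, 4, 3, 2]) :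
    x 3 = a 3 ∧ x 4 = a 4 ∧ x 7 = x 5 + a 2 ∧ x 7 = a 7 := by
  have := offsets_two h.1.1.1.1
  have := offsets_two_three h.1.1.1
  have := offsets_two_three_four h.1.1
  have := offsets_two_three_four_five h.1
  obtain ⟨h0, hp, hn, h⟩ := h.facts
  simp [OffsetNonadj, h0] at h hp hn
  obtain ⟨s2, h⟩ := h
  rcases s2 with s2 | s2 | s2 | s2 | s2 <;>
  grind (splits := 20)

theorem offsets_two_four_three_five_seven (h : OffsetOrder x a [7, 5, 3, 4, 2]) :
    x 3 = a 3 ∧ x 7 = x 5 + a 2 ∧ x 7 = a 7 := by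
  have := offsets_two h.1.1.1.1
  have := offsets_two_four h.1.1.1
  have := offsets_two_four_three h.1.1
  have := offsets_two_four_three_five h.1
  obtain ⟨h0, hp, hn, h⟩ := h.facts
  simp [OffsetNonadj, h0] at h hp hn
  obtain ⟨s2, h⟩ := h
  rcases s2 with s2 | s2 | s2 | s2 | s2 <;>
  grind (splits := 20)

theorem offsets_two_four_three_six_five (h : OffsetOrder x a [5, 6, 3, 4, 2]) :
    x 5 = 7 * a 3 ∧ a 5 = 7 * a 3 := by
  have := offsets_two h.1.1.1.1
  have := offsets_two_four h.1.1.1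
  have := offsets_two_four_three h.1.1
  have := offsets_two_four_three_six h.1
  obtain ⟨h0, hp, hn, h⟩ := h.facts
  simp [OffsetNonadj, h0] at h hp hn
  obtain ⟨s2, h⟩ := h
  rcases s2 with s2 | s2 | s2 | s2 | s2 <;>
  grind (splits := 20)

theorem offsets_three_two_five_four_seven (h : OffsetOrder x a [7, 4, 5, 2, 3]) :
    x 4 = a 4 ∧ x 7 = x 4 + a 3 ∧ x 7 = a 7 := by
  have := offsets_three h.1.1.1.1
  have := offsets_three_two h.1.1.1
  have := offsets_three_two_five h.1.1
  have := offsets_three_two_five_four h.1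
  obtain ⟨h0, hp, hn, h⟩ := h.facts
  simp [OffsetNonadj, h0] at h hp hn
  obtain ⟨s2, h⟩ := h
  rcases s2 with s2 | s2 | s2 | s2 | s2 <;>
  grind (splits := 20)

theorem offsets_three_four_two_five_six (h : OffsetOrder x a [6, 5, 2, 4, 3]) :
    x 6 = 7 * a 2 ∧ a 6 = 7 * a 2 := by
  have := offsets_three h.1.1.1.1
  have := offsets_three_four h.1.1.1
  have := offsets_three_four_two h.1.1
  have := offsets_three_four_two_five h.1
  obtain ⟨h0, hp, hn, h⟩ := h.facts
  simp [OffsetNonadj, h0] at h hp hn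
  obtain ⟨s2, h⟩ := h
  rcases s2 with s2 | s2 | s2 | s2 | s2 <;>
  grind (splits := 20)

theorem offsets_three_four_five_six (h : OffsetOrder x a [6, 5, 4, 3]) :
    a 3 = 2 * a 2 ∧ x 4 = 3 * a 2 := by
  have := offsets_three h.1.1.1
  have := offsets_three_four h.1.1
  have := offsets_three_four_five h.1
  obtain ⟨h0, hp, hn, h⟩ := h.facts
  simp [OffsetNonadj, h0] at h hp hn
  obtain ⟨s2, h⟩ := h
  rcases s2 with s2 | s2 | s2 | s2 <;>
  grind (splits := 20)

/-! ### Orders of the top labels with inconsistent systems -/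

theorem offsets_two_four_five (h : OffsetOrder x a [5, 4, 2]) : False := by
  have := offsets_two h.1.1
  have := offsets_two_four h.1
  obtain ⟨h0, hp, hn, h⟩ := h.facts
  simp [OffsetNonadj, h0] at h hp hn
  obtain ⟨s2, h⟩ := h
  rcases s2 with s2 | s2 | s2 <;>
  grind (splits := 20)

theorem offsets_two_three_five_four (h : OffsetOrder x a [4, 5, 3, 2]) : False := by
  have := offsets_two h.1.1.1
  have := offsets_two_three h.1.1
  have := offsets_two_three_five h.1
  obtain ⟨h0, hp, hn, h⟩ := h.facts
  simp [OffsetNonadj, h0] at h hp hn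
  obtain ⟨s2, h⟩ := h
  rcases s2 with s2 | s2 | s2 | s2 <;>
  grind (splits := 20)

theorem offsets_two_three_five_six (h : OffsetOrder x a [6, 5, 3, 2]) : False := by
  have := offsets_two h.1.1.1
  have := offsets_two_three h.1.1
  have := offsets_two_three_five h.1
  obtain ⟨h0, hp, hn, h⟩ := h.facts
  simp [OffsetNonadj, h0] at h hp hn
  obtain ⟨s2, h⟩ := h
  rcases s2 with s2 | s2 | s2 | s2 <;>
  grind (splits := 20)

theorem offsets_two_three_four_six_five (h : OffsetOrder x a [5, 6, 4, 3, 2]) : False := by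
  have := offsets_two h.1.1.1.1
  have := offsets_two_three h.1.1.1
  have := offsets_two_three_four h.1.1
  have := offsets_two_three_four_six h.1
  obtain ⟨h0, hp, hn, h⟩ := h.facts
  simp [OffsetNonadj, h0] at h hp hn
  obtain ⟨s2, h⟩ := h
  rcases s2 with s2 | s2 | s2 | s2 | s2 <;>
  grind (splits := 20)

theorem offsets_two_three_four_six_seven (h : OffsetOrder x a [7, 6, 4, 3, 2]) : False := by
  have := offsets_two h.1.1.1.1
  have := offsets_two_three h.1.1.1
  have := offsets_two_three_four h.1.1
  have := offsets_two_three_four_six h.1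
  obtain ⟨h0, hp, hn, h⟩ := h.facts
  simp [OffsetNonadj, h0] at h hp hn
  obtain ⟨s2, h⟩ := h
  rcases s2 with s2 | s2 | s2 | s2 | s2 <;>
  grind (splits := 20)

theorem offsets_two_four_three_five_six (h : OffsetOrder x a [6, 5, 3, 4, 2]) : False := by
  have := offsets_two h.1.1.1.1
  have := offsets_two_four h.1.1.1
  have := offsets_two_four_three h.1.1
  have := offsets_two_four_three_five h.1
  obtain ⟨h0, hp, hn, h⟩ := h.facts
  simp [OffsetNonadj, h0] at h hp hn
  obtain ⟨s2, h⟩ := h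
  rcases s2 with s2 | s2 | s2 | s2 | s2 <;>
  grind (splits := 20)

theorem offsets_two_four_three_six_seven (h : OffsetOrder x a [7, 6, 3, 4, 2]) : False := by
  have := offsets_two h.1.1.1.1
  have := offsets_two_four h.1.1.1
  have := offsets_two_four_three h.1.1
  have := offsets_two_four_three_six h.1
  obtain ⟨h0, hp, hn, h⟩ := h.facts
  simp [OffsetNonadj, h0] at h hp hn
  obtain ⟨s2, h⟩ := h
  rcases s2 with s2 | s2 | s2 | s2 | s2 <;>
  grind (splits := 20)

theorem offsets_three_two_four_five_six (h : OffsetOrder x a [6, 5, 4, 2, 3]) : False := by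
  have := offsets_three h.1.1.1.1
  have := offsets_three_two h.1.1.1
  have := offsets_three_two_four h.1.1
  have := offsets_three_two_four_five h.1
  obtain ⟨h0, hp, hn, h⟩ := h.facts
  simp [OffsetNonadj, h0] at h hp hn
  obtain ⟨s2, h⟩ := h
  rcases s2 with s2 | s2 | s2 | s2 | s2 <;>
  grind (splits := 20)

theorem offsets_three_two_four_five_seven (h : OffsetOrder x a [7, 5, 4, 2, 3]) : False := by
  have := offsets_three h.1.1.1.1
  have := offsets_three_two h.1.1.1
  have := offsets_three_two_four h.1.1
  have := offsets_three_two_four_five h.1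
  obtain ⟨h0, hp, hn, h⟩ := h.facts
  simp [OffsetNonadj, h0] at h hp hn
  obtain ⟨s2, h⟩ := h
  rcases s2 with s2 | s2 | s2 | s2 | s2 <;>
  grind (splits := 20)

theorem offsets_three_two_four_six_five (h : OffsetOrder x a [5, 6, 4, 2, 3]) : False := by
  have := offsets_three h.1.1.1.1
  have := offsets_three_two h.1.1.1
  have := offsets_three_two_four h.1.1
  have := offsets_three_two_four_six h.1
  obtain ⟨h0, hp, hn, h⟩ := h.facts
  simp [OffsetNonadj, h0] at h hp hn
  obtain ⟨s2, h⟩ := h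
  rcases s2 with s2 | s2 | s2 | s2 | s2 <;>
  grind (splits := 20)

theorem offsets_three_two_four_six_seven (h : OffsetOrder x a [7, 6, 4, 2, 3]) : False := by
  have := offsets_three h.1.1.1.1
  have := offsets_three_two h.1.1.1
  have := offsets_three_two_four h.1.1
  have := offsets_three_two_four_six h.1
  -- `OffsetNonadj` only records `i ≤ 6`; here the nonadjacency of `7` and `n` is needed too.
  have h7 := (h.1.1.1.2.2 7 (by simp)).not.1 (by simp)
  obtain ⟨h0, hp, hn, h⟩ := h.facts
  simp [OffsetNonadj, h0] at h hp hn h7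
  obtain ⟨s2, h⟩ := h
  rcases s2 with s2 | s2 | s2 | s2 | s2 <;>
  grind (splits := 20)

theorem offsets_three_two_five_four_six (h : OffsetOrder x a [6, 4, 5, 2, 3]) : False := by
  have := offsets_three h.1.1.1.1
  have := offsets_three_two h.1.1.1
  have := offsets_three_two_five h.1.1
  have := offsets_three_two_five_four h.1
  obtain ⟨h0, hp, hn, h⟩ := h.facts
  simp [OffsetNonadj, h0] at h hp hn
  obtain ⟨s2, h⟩ := h
  rcases s2 with s2 | s2 | s2 | s2 | s2 <;>
  grind (splits := 20)

theorem offsets_three_two_five_six (h : OffsetOrder x a [6, 5, 2, 3]) : False := by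
  have := offsets_three h.1.1.1
  have := offsets_three_two h.1.1
  have := offsets_three_two_five h.1
  obtain ⟨h0, hp, hn, h⟩ := h.facts
  simp [OffsetNonadj, h0] at h hp hn
  obtain ⟨s2, h⟩ := h
  rcases s2 with s2 | s2 | s2 | s2 <;>
  grind (splits := 20)

theorem offsets_three_four_two_five_seven (h : OffsetOrder x a [7, 5, 2, 4, 3]) : False := by
  have := offsets_three h.1.1.1.1
  have := offsets_three_four h.1.1.1
  have := offsets_three_four_two h.1.1
  have := offsets_three_four_two_five h.1
  obtain ⟨h0, hp, hn, h⟩ := h.facts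
  simp [OffsetNonadj, h0] at h hp hn
  obtain ⟨s2, h⟩ := h
  rcases s2 with s2 | s2 | s2 | s2 | s2 <;>
  grind (splits := 20)

theorem offsets_three_four_two_six (h : OffsetOrder x a [6, 2, 4, 3]) : False := by
  have := offsets_three h.1.1.1
  have := offsets_three_four h.1.1
  have := offsets_three_four_two h.1
  obtain ⟨h0, hp, hn, h⟩ := h.facts
  simp [OffsetNonadj, h0] at h hp hn
  obtain ⟨s2, h⟩ := h
  rcases s2 with s2 | s2 | s2 | s2 <;>
  grind (splits := 20)

theorem offsets_three_four_five_two (h : OffsetOrder x a [2, 5, 4, 3]) : False := by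
  have := offsets_three h.1.1.1
  have := offsets_three_four h.1.1
  have := offsets_three_four_five h.1
  obtain ⟨h0, hp, hn, h⟩ := h.facts
  simp [OffsetNonadj, h0] at h hp hn
  obtain ⟨s2, h⟩ := h
  rcases s2 with s2 | s2 | s2 | s2 <;>
  grind (splits := 20)

theorem offsets_two_three_four_five_seven_six (h : OffsetOrder x a [6, 7, 5, 4, 3, 2]) : False := by
  have := offsets_two h.1.1.1.1.1
  have := offsets_two_three h.1.1.1.1
  have := offsets_two_three_four h.1.1.1
  have := offsets_two_three_four_five h.1.1
  have := offsets_two_three_four_five_seven h.1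
  obtain ⟨h0, hp, hn, h⟩ := h.facts
  simp [OffsetNonadj, h0] at h hp hn
  obtain ⟨s2, h⟩ := h
  rcases s2 with s2 | s2 | s2 | s2 | s2 | s2 <;>
  grind (splits := 20)

theorem offsets_two_three_four_five_seven_eight (h : OffsetOrder x a [8, 7, 5, 4, 3, 2]) : False := by
  have := offsets_two h.1.1.1.1.1
  have := offsets_two_three h.1.1.1.1
  have := offsets_two_three_four h.1.1.1
  have := offsets_two_three_four_five h.1.1
  have := offsets_two_three_four_five_seven h.1
  obtain ⟨h0, hp, hn, h⟩ := h.facts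
  simp [OffsetNonadj, h0] at h hp hn
  obtain ⟨s2, h⟩ := h
  rcases s2 with s2 | s2 | s2 | s2 | s2 | s2 <;>
  grind (splits := 20)

theorem offsets_two_four_three_five_seven_six (h : OffsetOrder x a [6, 7, 5, 3, 4, 2]) : False := by
  have := offsets_two h.1.1.1.1.1
  have := offsets_two_four h.1.1.1.1
  have := offsets_two_four_three h.1.1.1
  have := offsets_two_four_three_five h.1.1
  have := offsets_two_four_three_five_seven h.1
  obtain ⟨h0, hp, hn, h⟩ := h.facts
  simp [OffsetNonadj, h0] at h hp hn
  obtain ⟨s2, h⟩ := h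
  rcases s2 with s2 | s2 | s2 | s2 | s2 | s2 <;>
  grind (splits := 20)

theorem offsets_two_four_three_five_seven_eight (h : OffsetOrder x a [8, 7, 5, 3, 4, 2]) : False := by
  have := offsets_two h.1.1.1.1.1
  have := offsets_two_four h.1.1.1.1
  have := offsets_two_four_three h.1.1.1
  have := offsets_two_four_three_five h.1.1
  have := offsets_two_four_three_five_seven h.1
  obtain ⟨h0, hp, hn, h⟩ := h.facts
  simp [OffsetNonadj, h0] at h hp hn
  obtain ⟨s2, h⟩ := h
  rcases s2 with s2 | s2 | s2 | s2 | s2 | s2 <;>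
  grind (splits := 20)

theorem offsets_two_four_three_six_five_seven (h : OffsetOrder x a [7, 5, 6, 3, 4, 2]) : False := by
  have := offsets_two h.1.1.1.1.1
  have := offsets_two_four h.1.1.1.1
  have := offsets_two_four_three h.1.1.1
  have := offsets_two_four_three_six h.1.1
  have := offsets_two_four_three_six_five h.1
  obtain ⟨h0, hp, hn, h⟩ := h.facts
  simp [OffsetNonadj, h0] at h hp hn
  obtain ⟨s2, h⟩ := h
  rcases s2 with s2 | s2 | s2 | s2 | s2 | s2 <;>
  grind (splits := 20)

theorem offsets_two_four_three_six_five_eight (h : OffsetOrder x a [8, 5, 6, 3, 4, 2]) : False := by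
  have := offsets_two h.1.1.1.1.1
  have := offsets_two_four h.1.1.1.1
  have := offsets_two_four_three h.1.1.1
  have := offsets_two_four_three_six h.1.1
  have := offsets_two_four_three_six_five h.1
  obtain ⟨h0, hp, hn, h⟩ := h.facts
  simp [OffsetNonadj, h0] at h hp hn
  obtain ⟨s2, h⟩ := h
  rcases s2 with s2 | s2 | s2 | s2 | s2 | s2 <;>
  grind (splits := 20)

theorem offsets_three_two_five_four_seven_six (h : OffsetOrder x a [6, 7, 4, 5, 2, 3]) : False := by
  have := offsets_three h.1.1.1.1.1
  have := offsets_three_two h.1.1.1.1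
  have := offsets_three_two_five h.1.1.1
  have := offsets_three_two_five_four h.1.1
  have := offsets_three_two_five_four_seven h.1
  obtain ⟨h0, hp, hn, h⟩ := h.facts
  simp [OffsetNonadj, h0] at h hp hn
  obtain ⟨s2, h⟩ := h
  rcases s2 with s2 | s2 | s2 | s2 | s2 | s2 <;>
  grind (splits := 20)

theorem offsets_three_two_five_four_seven_eight (h : OffsetOrder x a [8, 7, 4, 5, 2, 3]) : False := by
  have := offsets_three h.1.1.1.1.1
  have := offsets_three_two h.1.1.1.1
  have := offsets_three_two_five h.1.1.1
  have := offsets_three_two_five_four h.1.1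
  have := offsets_three_two_five_four_seven h.1
  obtain ⟨h0, hp, hn, h⟩ := h.facts
  simp [OffsetNonadj, h0] at h hp hn
  obtain ⟨s2, h⟩ := h
  rcases s2 with s2 | s2 | s2 | s2 | s2 | s2 <;>
  grind (splits := 20)

theorem offsets_three_four_two_five_six_seven (h : OffsetOrder x a [7, 6, 5, 2, 4, 3]) : False := by
  have := offsets_three h.1.1.1.1.1
  have := offsets_three_four h.1.1.1.1
  have := offsets_three_four_two h.1.1.1
  have := offsets_three_four_two_five h.1.1
  have := offsets_three_four_two_five_six h.1
  obtain ⟨h0, hp, hn, h⟩ := h.facts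
  simp [OffsetNonadj, h0] at h hp hn
  obtain ⟨s2, h⟩ := h
  rcases s2 with s2 | s2 | s2 | s2 | s2 | s2 <;>
  grind (splits := 20)

theorem offsets_three_four_two_five_six_eight (h : OffsetOrder x a [8, 6, 5, 2, 4, 3]) : False := by
  have := offsets_three h.1.1.1.1.1
  have := offsets_three_four h.1.1.1.1
  have := offsets_three_four_two h.1.1.1
  have := offsets_three_four_two_five h.1.1
  have := offsets_three_four_two_five_six h.1
  obtain ⟨h0, hp, hn, h⟩ := h.facts
  simp [OffsetNonadj, h0] at h hp hn
  obtain ⟨s2, h⟩ := h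
  rcases s2 with s2 | s2 | s2 | s2 | s2 | s2 <;>
  grind (splits := 20)

end offsets

/-! ### The search tree of orders and its two surviving branches -/

theorem OffsetOrder.exists_chain {x a : ℕ → ℕ} {P : List ℕ → Prop}
    (hP : ∀ J, P J → OffsetOrder x a J) (hnil : P [])
    (hnext : ∀ J, P J → J.length ≤ 5 → ∃ j, 2 ≤ j ∧ j ≤ J.length + 3 ∧ j ∉ J ∧ P (j :: J)) :
    P [6, 5, 4, 3, 2] ∨ P [6, 5, 4, 3] := by
  -- The tree is binary: the indices from `2` to `J.length + 3` number `J.length + 2` and include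
  -- all of `J`, so two are left.
  have key : ∀ {J : List ℕ} (u v : ℕ), P J → J.length ≤ 5 →
      (∀ j, 2 ≤ j → j ≤ J.length + 3 → j ∉ J → j = u ∨ j = v) → P (u :: J) ∨ P (v :: J) := by
    intro J u v hJ hl huv
    obtain ⟨j, h1, h2, h3, h4⟩ := hnext J hJ hl
    rcases huv j h1 h2 h3 with rfl | rfl
    exacts [Or.inl h4, Or.inr h4]
  rcases key 2 3 hnil (by simp) (by simp; omega) with h | h
  · rcases key 3 4 h (by simp) (by simp; omega) with h | h
    · rcases key 4 5 h (by simp) (by simp; omega) with h | h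
      · rcases key 5 6 h (by simp) (by simp; omega) with h | h
        · rcases key 6 7 h (by simp) (by simp; omega) with h | h
          · exact Or.inl h
          · rcases key 6 8 h (by simp) (by simp; omega) with h | h
            · exact (offsets_two_three_four_five_seven_six (hP _ h)).elim
            · exact (offsets_two_three_four_five_seven_eight (hP _ h)).elim
        · rcases key 5 7 h (by simp) (by simp; omega) with h | h
          · exact (offsets_two_three_four_six_five (hP _ h)).elim
          · exact (offsets_two_three_four_six_seven (hP _ h)).elim
      · rcases key 4 6 h (by simp) (by simp; omega) with h | h
        · exact (offsets_two_three_five_four (hP _ h)).elim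
        · exact (offsets_two_three_five_six (hP _ h)).elim
    · rcases key 3 5 h (by simp) (by simp; omega) with h | h
      · rcases key 5 6 h (by simp) (by simp; omega) with h | h
        · rcases key 6 7 h (by simp) (by simp; omega) with h | h
          · exact (offsets_two_four_three_five_six (hP _ h)).elim
          · rcases key 6 8 h (by simp) (by simp; omega) with h | h
            · exact (offsets_two_four_three_five_seven_six (hP _ h)).elim
            · exact (offsets_two_four_three_five_seven_eight (hP _ h)).elim
        · rcases key 5 7 h (by simp) (by simp; omega) with h | h
          · rcases key 7 8 h (by simp) (by simp; omega) with h | h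
            · exact (offsets_two_four_three_six_five_seven (hP _ h)).elim
            · exact (offsets_two_four_three_six_five_eight (hP _ h)).elim
          · exact (offsets_two_four_three_six_seven (hP _ h)).elim
      · exact (offsets_two_four_five (hP _ h)).elim
  · rcases key 2 4 h (by simp) (by simp; omega) with h | h
    · rcases key 4 5 h (by simp) (by simp; omega) with h | h
      · rcases key 5 6 h (by simp) (by simp; omega) with h | h
        · rcases key 6 7 h (by simp) (by simp; omega) with h | h
          · exact (offsets_three_two_four_five_six (hP _ h)).elim
          · exact (offsets_three_two_four_five_seven (hP _ h)).elim
        · rcases key 5 7 h (by simp) (by simp; omega) with h | h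
          · exact (offsets_three_two_four_six_five (hP _ h)).elim
          · exact (offsets_three_two_four_six_seven (hP _ h)).elim
      · rcases key 4 6 h (by simp) (by simp; omega) with h | h
        · rcases key 6 7 h (by simp) (by simp; omega) with h | h
          · exact (offsets_three_two_five_four_six (hP _ h)).elim
          · rcases key 6 8 h (by simp) (by simp; omega) with h | h
            · exact (offsets_three_two_five_four_seven_six (hP _ h)).elim
            · exact (offsets_three_two_five_four_seven_eight (hP _ h)).elim
        · exact (offsets_three_two_five_six (hP _ h)).elim
    · rcases key 2 5 h (by simp) (by simp; omega) with h | h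
      · rcases key 5 6 h (by simp) (by simp; omega) with h | h
        · rcases key 6 7 h (by simp) (by simp; omega) with h | h
          · rcases key 7 8 h (by simp) (by simp; omega) with h | h
            · exact (offsets_three_four_two_five_six_seven (hP _ h)).elim
            · exact (offsets_three_four_two_five_six_eight (hP _ h)).elim
          · exact (offsets_three_four_two_five_seven (hP _ h)).elim
        · exact (offsets_three_four_two_six (hP _ h)).elim
      · rcases key 2 6 h (by simp) (by simp; omega) with h | h
        · exact (offsets_three_four_five_two (hP _ h)).elim
        · exact Or.inr h

/-! ### Label sets and their largest elements -/

theorem exists_max_mem {L : Finset ℕ} {Q : ℕ → Prop} (h : ∃ l ∈ L, Q l) :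
    ∃ b ∈ L, Q b ∧ ∀ l ∈ L, Q l → l ≤ b := by
  classical
  obtain ⟨l, hl, hQ⟩ := h
  obtain ⟨b, hb, hmax⟩ := (L.filter Q).exists_max_image id ⟨l, Finset.mem_filter.2 ⟨hl, hQ⟩⟩
  rw [Finset.mem_filter] at hb
  exact ⟨b, hb.1, hb.2, fun m hm hQm => hmax m (Finset.mem_filter.2 ⟨hm, hQm⟩)⟩

theorem mem_setA {n i : ℕ} : i ∈ setA n ↔ i = n + 2 ∨ 2 ≤ i ∧ i ≤ n := by
  simp [setA]

/-- The set `L` of labels of a sum labeling of a graph in `C(A_n)`; `f l` is the vertex of `A_n`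
replaced by the vertices with label `l`. -/
structure IsLabelSet (n : ℕ) (L : Finset ℕ) (f : ℕ → ℕ) : Prop where
  pos : ∀ l ∈ L, 0 < l
  mem : ∀ l ∈ L, f l ∈ setA n
  surj : ∀ i ∈ setA n, ∃ l ∈ L, f l = i
  add_mem_iff : ∀ l ∈ L, ∀ m ∈ L, l ≠ m → (l + m ∈ L ↔ f l + f m ∈ setA n)
  inj : ∀ l ∈ L, ∀ m ∈ L, f l = f m → f l + f l ∉ setA n → l = m
  double : ∀ l ∈ L, f l + f l ∈ setA n → l + l ∈ L ∨ ∃ m ∈ L, m ≠ l ∧ f m = f l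

/-- The largest labels are those of the vertices `n + 2 - j` with `j = 0` or `j` in the list. -/
def IsTop (n : ℕ) (L : Finset ℕ) (g : ℕ → ℕ) (J : List ℕ) : Prop :=
  OffsetOrder (fun j => g (n + 2) - g (n + 2 - j)) g J ∧ (∀ j ∈ J, 2 ≤ j ∧ j ≤ 8) ∧
    ∀ l ∈ L, (∃ t ∈ 0 :: J, l = g (n + 2 - t)) ∨ ∀ t ∈ 0 :: J, l < g (n + 2 - t)

namespace IsLabelSet

variable {n : ℕ} {L : Finset ℕ} {f g : ℕ → ℕ}

/-- A class above `(n + 2) / 2` has no loop, hence only one label. -/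
theorem eq_of_large (h : IsLabelSet n L f) (hg : ∀ i ∈ setA n, g i ∈ L ∧ f (g i) = i) {l : ℕ}
    (hl : l ∈ L) (hf : n + 2 < f l + f l) : l = g (f l) := by
  have hm := hg _ (h.mem l hl)
  refine h.inj l hl _ hm.1 hm.2.symm ?_
  rw [mem_setA]
  omega

theorem le_top (h : IsLabelSet n L f) (hn : 39 ≤ n) (hg : ∀ i ∈ setA n, g i ∈ L ∧ f (g i) = i)
    {l : ℕ} (hl : l ∈ L) : l ≤ g (n + 2) := by
  obtain ⟨b, hb, hmax⟩ := L.exists_max_image id ⟨l, hl⟩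
  have hstep : ∀ i ∈ setA n, i ≠ f b → f b + i ∉ setA n := by
    intro i hi hib hmem
    have hi' := hg i hi
    have hne : b ≠ g i := fun e => hib (by rw [e, hi'.2])
    have hs := (h.add_mem_iff b hb _ hi'.1 hne).2 (by rwa [hi'.2])
    have h1 := hmax _ hs
    have h2 := h.pos _ hi'.1
    simp at h1
    omega
  have hfb := mem_setA.1 (h.mem b hb)
  simp only [mem_setA] at hstep
  -- Nothing can be added to the largest label, and every class other than `n + 2` is adjacent to
  -- `2` or `3` in a different class.
  have hfb' : f b = n + 2 := by
    have h2 := hstep 2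
    have h3 := hstep 3
    have h11 := hstep 11
    omega
  have := h.eq_of_large hg hb (by omega)
  rw [hfb'] at this
  rw [← this]
  exact hmax l hl

theorem isTop_nil (h : IsLabelSet n L f) (hn : 39 ≤ n)
    (hg : ∀ i ∈ setA n, g i ∈ L ∧ f (g i) = i) : IsTop n L g [] := by
  refine ⟨⟨by simp, ?_⟩, by simp, fun l hl => ?_⟩
  · have : ∀ i j, 2 ≤ i → i ≤ 8 → 2 ≤ j → j ≤ 8 → g i = g j → i = j := by
      intro i j hi hi' hj hj' e
      rw [← (hg i (mem_setA.2 (by omega))).2, e, (hg j (mem_setA.2 (by omega))).2]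
    have e : [g 2, g 3, g 4, g 5, g 6, g 7, g 8] = [2, 3, 4, 5, 6, 7, 8].map g := rfl
    rw [e]
    refine List.Nodup.map_on ?_ (by decide)
    intro i hi j hj
    simp at hi hj
    exact this i j (by omega) (by omega) (by omega) (by omega)
  · have := h.le_top hn hg hl
    simp
    omega

/-- The map `i ↦ b + g i` injects neighbouring classes of `f b` into the labels above `b`. -/
theorem card_le_of_isTop (h : IsLabelSet n L f) (hg : ∀ i ∈ setA n, g i ∈ L ∧ f (g i) = i)
    {J : List ℕ} {b : ℕ} (hb : b ∈ L)
    (hmax : ∀ l ∈ L, b < l → ∃ t ∈ 0 :: J, l = g (n + 2 - t)) (N : Finset ℕ)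
    (hN : ∀ i ∈ N, i ∈ setA n ∧ i ≠ f b ∧ f b + i ∈ setA n) : N.card ≤ J.length + 1 := by
  have hle : N.card ≤ (((0 :: J).map fun t => g (n + 2 - t)).toFinset).card := by
    refine Finset.card_le_card_of_injOn (fun i => b + g i) ?_ ?_
    · intro i hi
      obtain ⟨h1, h2, h3⟩ := hN i hi
      have hi' := hg i h1
      have hne : b ≠ g i := fun e => h2 (by rw [e, hi'.2])
      have hs := (h.add_mem_iff b hb _ hi'.1 hne).2 (by rwa [hi'.2])
      obtain ⟨t, ht, e⟩ := hmax _ hs (by have := h.pos _ hi'.1; omega)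
      rw [Finset.mem_coe, List.mem_toFinset, List.mem_map]
      exact ⟨t, ht, e.symm⟩
    · intro i hi j hj e
      rw [← (hg i (hN i hi).1).2, ← (hg j (hN j hj).1).2, Nat.add_left_cancel e]
  refine hle.trans ((List.toFinset_card_le _).trans ?_)
  simp

/-- Any smaller class has at least `J.length + 2` neighbouring classes other than itself, one more
than there are labels above `b`. -/
theorem le_class_of_isTop (h : IsLabelSet n L f) (hn : 39 ≤ n)
    (hg : ∀ i ∈ setA n, g i ∈ L ∧ f (g i) = i) {J : List ℕ} (hJ : J.length ≤ 5) {b : ℕ}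
    (hb : b ∈ L) (hmax : ∀ l ∈ L, b < l → ∃ t ∈ 0 :: J, l = g (n + 2 - t)) :
    n ≤ f b + J.length + 1 := by
  by_contra! hlt
  have hcard := h.card_le_of_isTop hg hb hmax
  have hfb := mem_setA.1 (h.mem b hb)
  simp only [mem_setA] at hcard
  rcases Nat.lt_or_ge 10 (f b) with h10 | h10
  · rcases Nat.lt_or_ge (f b + J.length + 2) n with hlt' | hge
    · have := hcard (Finset.Icc 2 (J.length + 3)) fun i hi => by
        rw [Finset.mem_Icc] at hi
        omega
      simp at this
    -- Here `f b + J.length + 2 = n`, so `J.length + 3` would give the missing sum `n + 1`, while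
    -- `J.length + 4` gives `n + 2`.
    · have := hcard (insert (J.length + 4) (Finset.Icc 2 (J.length + 2))) fun i hi => by
        rw [Finset.mem_insert, Finset.mem_Icc] at hi
        omega
      rw [Finset.card_insert_of_notMem (by simp)] at this
      simp at this
  -- Starting at `11` keeps the neighbours distinct from `f b ≤ 10`.
  · have := hcard (Finset.Icc 11 (J.length + 12)) fun i hi => by
      rw [Finset.mem_Icc] at hi
      omega
    simp at this

/-- The next entry is the class of the largest label `b` not yet listed. Any sum `b + g i` that is a
label exceeds `b`, so it is already listed; this turns adjacency into an equation between offsets.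
-/
theorem exists_isTop_cons (h : IsLabelSet n L f) (hn : 39 ≤ n)
    (hg : ∀ i ∈ setA n, g i ∈ L ∧ f (g i) = i) {J : List ℕ} (hJ : J.length ≤ 5)
    (hT : IsTop n L g J) :
    ∃ j, 2 ≤ j ∧ j ≤ J.length + 3 ∧ j ∉ J ∧ IsTop n L g (j :: J) := by
  obtain ⟨hO, hJ8, hup⟩ := hT
  have ht8 : ∀ t ∈ 0 :: J, t = 0 ∨ 2 ≤ t ∧ t ≤ 8 := by
    intro t ht
    rcases List.mem_cons.1 ht with ht | ht
    exacts [Or.inl ht, Or.inr (hJ8 t ht)]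
  have hgt : ∀ t ∈ 0 :: J, g (n + 2 - t) ∈ L ∧ f (g (n + 2 - t)) = n + 2 - t := by
    intro t ht
    have := ht8 t ht
    exact hg _ (mem_setA.2 (by omega))
  obtain ⟨b, hbL, hbt, hmax⟩ :=
      exists_max_mem (L := L) (Q := fun l => ∀ t ∈ 0 :: J, l < g (n + 2 - t)) (by
    have h2 := hg 2 (mem_setA.2 (by omega))
    refine ⟨g 2, h2.1, (hup _ h2.1).resolve_left ?_⟩
    rintro ⟨t, ht, e⟩
    have h3 := (hgt t ht).2
    have := ht8 t ht
    rw [← e, h2.2] at h3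
    omega)
  have hlt : ∀ l ∈ L, b < l → ∃ t ∈ 0 :: J, l = g (n + 2 - t) := by
    intro l hl hbl
    refine (hup l hl).resolve_right fun hlt => ?_
    have := hmax l hl hlt
    omega
  have hle := h.le_class_of_isTop hn hg hJ hbL hlt
  have hfb := mem_setA.1 (h.mem b hbL)
  have hbg := h.eq_of_large hg hbL (by omega)
  have hfb2 : f b ≠ n + 2 := by
    intro e
    have := hbt 0 (by simp)
    rw [e] at hbg
    simp at this
    omega
  obtain ⟨j, hj⟩ : ∃ j, f b = n + 2 - j ∧ 2 ≤ j ∧ j ≤ J.length + 3 :=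
    ⟨n + 2 - f b, by omega, by omega, by omega⟩
  obtain ⟨hfj, hj2, hj3⟩ := hj
  rw [hfj] at hbg
  have htop : ∀ {l}, l ∈ L → l ≤ g (n + 2) := h.le_top hn hg
  refine ⟨j, hj2, hj3, fun hjJ => ?_, ⟨hO, fun t ht => ?_, fun i hi => ?_⟩, ?_, fun l hl => ?_⟩
  · have := hbt j (List.mem_cons_of_mem _ hjJ)
    omega
  · have h1 := hbt t ht
    have h2 := htop (hgt t ht).1
    simp only
    omega
  · have hi' : 2 ≤ i ∧ i ≤ 8 := by
      simp at hi
      omega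
    have hgi := hg i (mem_setA.2 (by omega))
    have hne : b ≠ g i := by
      intro e
      have h3 := hgi.2
      rw [← e, hfj] at h3
      omega
    have hadj := h.add_mem_iff b hbL _ hgi.1 hne
    rw [hgi.2, hfj, mem_setA] at hadj
    have hbtop := htop hbL
    have hpos := h.pos _ hgi.1
    simp only [← hbg]
    constructor
    · intro hij
      obtain ⟨t, ht, e⟩ := hlt _ (hadj.2 (by omega)) (by omega)
      have := htop (hgt t ht).1
      exact ⟨t, ht, by omega⟩
    · rintro ⟨t, ht, e⟩
      have h2 := htop (hgt t ht).1
      have h3 := hbt t ht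
      have h4 : b + g i = g (n + 2 - t) := by omega
      have := hadj.1 (h4 ▸ (hgt t ht).1)
      omega
  · intro t ht
    rcases List.mem_cons.1 ht with rfl | ht
    exacts [by omega, hJ8 t ht]
  · rcases hup l hl with ⟨t, ht, e⟩ | hlt
    · refine Or.inl ⟨t, ?_, e⟩
      simp at ht ⊢
      tauto
    · have hlb := hmax l hl hlt
      rcases hlb.eq_or_lt with e | hlb
      · exact Or.inl ⟨j, by simp, e.trans hbg⟩
      · refine Or.inr fun t ht => ?_
        rw [List.mem_cons, List.mem_cons] at ht
        rcases ht with rfl | rfl | ht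
        · exact hlt 0 (by simp)
        · exact hbg ▸ hlb
        · exact hlt t (by simp [ht])

/-- Only `n + 2` and `n - 1` are nonadjacent to `2`, and each of them has a single label. -/
theorem add_class_two_mem (h : IsLabelSet n L f) (hn : 39 ≤ n)
    (hg : ∀ i ∈ setA n, g i ∈ L ∧ f (g i) = i) {l : ℕ} (hl : l ∈ L) (hl2 : l ≠ g 2) :
    l + g 2 ∈ L ∨ l = g (n + 2) ∨ l = g (n - 1) := by
  have h2 := hg 2 (mem_setA.2 (by omega))
  have hadj := h.add_mem_iff l hl _ h2.1 hl2
  rw [h2.2, mem_setA] at hadj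
  have hfl := mem_setA.1 (h.mem l hl)
  by_cases hs : f l = n + 2 ∨ f l = n - 1
  · have := h.eq_of_large hg hl (by omega)
    rcases hs with e | e <;> rw [e] at this <;> tauto
  · exact Or.inl (hadj.2 (by omega))

/-- Labels cannot start with the vertices `n + 2`, `n - 1`, `n - 2`, `n - 3`, `n - 4`. -/
theorem not_isTop_without_two (h : IsLabelSet n L f) (hn : 39 ≤ n)
    (hg : ∀ i ∈ setA n, g i ∈ L ∧ f (g i) = i) : ¬ IsTop n L g [6, 5, 4, 3] := by
  intro hT
  have h1 := offsets_three hT.1.1.1.1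
  have h2 := offsets_three_four_five_six hT.1
  have e0 : n + 2 - 2 = n := by omega
  have e1 : n + 2 - 3 = n - 1 := by omega
  have e2 : n + 2 - 4 = n - 2 := by omega
  simp only [e1, e2] at h1 h2
  have g2 := hg 2 (mem_setA.2 (by omega))
  have g3 := hg 3 (mem_setA.2 (by omega))
  have gn := hg n (mem_setA.2 (by omega))
  have gn1 := hg (n - 1) (mem_setA.2 (by omega))
  have gn2 := hg (n - 2) (mem_setA.2 (by omega))
  have hne : ∀ i j, f (g i) = i → f (g j) = j → i ≠ j → g i ≠ g j := by
    intro i j hi hj hij e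
    exact hij (by rw [← hi, e, hj])
  have p2 := h.pos _ g2.1
  have pn := h.pos _ gn.1
  have t1 := h.le_top hn hg gn1.1
  have t2 := h.le_top hn hg gn2.1
  have hs : g n + g 2 ∈ L := by
    rw [h.add_mem_iff _ gn.1 _ g2.1 (hne _ _ gn.2 g2.2 (by omega)), gn.2, g2.2, mem_setA]
    omega
  -- Since `g 3 = 2 * g 2`, this is the nonadjacency of `n` and `3`. Thus `g 2` cannot be added to
  -- `g n + g 2`, which must then be the label of `n + 2` or `n - 1`.
  have hs' : g n + g 2 + g 2 ∉ L := by
    have e : g n + g 2 + g 2 = g n + g 3 := by omega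
    rw [e, h.add_mem_iff _ gn.1 _ g3.1 (hne _ _ gn.2 g3.2 (by omega)), gn.2, g3.2, mem_setA]
    omega
  rcases h.add_class_two_mem hn hg hs (by omega) with hc | hc | hc
  · exact hs' hc
  -- Now `g n` is `g 2` below the top and `g (n - 1)` is `2 * g 2` below, so `n` would have to be in
  -- the list.
  · rcases hT.2.2 _ gn.1 with ⟨t, ht, e⟩ | hlt
    · have ht' : t = 0 ∨ 3 ≤ t ∧ t ≤ 6 := by
        simp at ht
        omega
      exact hne n (n + 2 - t) gn.2 (hg _ (mem_setA.2 (by omega))).2 (by omega) e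
    · have := hlt 3 (by simp)
      rw [e1] at this
      omega
  · exact hne n (n - 2) gn.2 gn2.2 (by omega) (by omega)

theorem one_notMem_of_isTop (h : IsLabelSet n L f) (hn : 39 ≤ n)
    (hg : ∀ i ∈ setA n, g i ∈ L ∧ f (g i) = i) (hT : IsTop n L g [6, 5, 4, 3, 2]) : 1 ∉ L := by
  intro hone
  have h1 := offsets_two hT.1.1.1.1.1
  have h2 := offsets_two_three_four_five_six hT.1
  have h3 := offsets_two_three_four_five hT.1.1
  have hp := hT.1.pairwise
  have e0 : n + 2 - 2 = n := by omega
  have e1 : n + 2 - 3 = n - 1 := by omega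
  have e2 : n + 2 - 4 = n - 2 := by omega
  simp only [e0, e1, e2] at h1 h2 h3
  have g2 := hg 2 (mem_setA.2 (by omega))
  have gn := hg n (mem_setA.2 (by omega))
  have gn1 := hg (n - 1) (mem_setA.2 (by omega))
  have gn2 := hg (n - 2) (mem_setA.2 (by omega))
  have p2 := h.pos _ g2.1
  have t0 := h.le_top hn hg gn.1
  have t1 := h.le_top hn hg gn1.1
  have t2 := h.le_top hn hg gn2.1
  obtain ⟨r, hr2, hr3⟩ : ∃ r, g 2 = 2 * r ∧ g 3 = 3 * r := ⟨g 3 - g 2, by omega, by omega⟩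
  -- For `m` of class `2`, `g n + m` is a label above `g n`, and the only such label is the top one.
  have huniq : ∀ m ∈ L, f m = 2 → m = g 2 := by
    intro m hm hfm
    have hne : g n ≠ m := by
      rintro rfl
      rw [gn.2] at hfm
      omega
    have hs : g n + m ∈ L := by
      rw [h.add_mem_iff _ gn.1 _ hm hne, gn.2, hfm, mem_setA]
      omega
    have hmpos := h.pos m hm
    simp [List.pairwise_cons] at hp
    rcases hT.2.2 _ hs with ⟨t, ht, e⟩ | hlt
    · simp at ht
      rcases ht with rfl | rfl | rfl | rfl | rfl | rfl <;> simp at e <;> omega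
    · have := hlt 2 (by simp)
      rw [e0] at this
      omega
  -- The copies of the looped vertex `2` all share one label and are adjacent. This covers the start
  -- of the chain, where `add_class_two_mem` does not apply.
  have hdouble : g 2 + g 2 ∈ L := by
    refine (h.double _ g2.1 ?_).resolve_right ?_
    · rw [g2.2, mem_setA]
      omega
    · rintro ⟨m, hm, hne, hfm⟩
      exact hne (huniq m hm (hfm.trans g2.2))
  -- Induction on a bound `k` for the distance from `l` to the top.
  have hchain : ∀ k l, l ∈ L → g (n + 2) ≤ l + k →
      ∃ q, l + 2 * r * q = g (n + 2) ∨ l + 2 * r * q = g (n - 1) := by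
    intro k
    induction k with
    | zero =>
      intro l hl hk
      have := h.le_top hn hg hl
      exact ⟨0, by omega⟩
    | succ k ih =>
      intro l hl hk
      have hstep : l + g 2 ∈ L ∨ l = g (n + 2) ∨ l = g (n - 1) := by
        by_cases hl2 : l = g 2
        · exact Or.inl (hl2 ▸ hdouble)
        · exact h.add_class_two_mem hn hg hl hl2
      rcases hstep with hs | hs
      · obtain ⟨q, hq⟩ := ih _ hs (by omega)
        exact ⟨q + 1, by rw [mul_add]; omega⟩
      · exact ⟨0, by omega⟩
  have hrM : r ∣ g (n + 2) := by
    obtain ⟨q, hq | hq⟩ := hchain _ _ g2.1 (Nat.le_add_left _ _)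
    · exact ⟨2 + 2 * q, by rw [← hq, hr2]; ring⟩
    · have : g (n + 2) = g (n - 1) + 3 * r := by omega
      exact ⟨5 + 2 * q, by rw [this, ← hq, hr2]; ring⟩
  have hr1 : r = 1 := by
    rw [← Nat.dvd_one]
    have hrn : r ∣ g (n - 1) := by
      have : g (n + 2) = g (n - 1) + 3 * r := by omega
      rw [this] at hrM
      exact (Nat.dvd_add_left (Dvd.intro_left 3 rfl)).1 hrM
    have hd : ∀ q, r ∣ 2 * r * q := fun q => ⟨2 * q, by ring⟩
    obtain ⟨q, hq | hq⟩ := hchain _ _ hone (Nat.le_add_left _ _)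
    · exact (Nat.dvd_add_left (hd q)).1 (hq ▸ hrM)
    · exact (Nat.dvd_add_left (hd q)).1 (hq ▸ hrn)
  subst hr1
  -- With `r = 1` the labels of `n`, `n - 1`, `n - 2` are consecutive. Adjacency to `n - 1` forces
  -- the class of `1` to be `3`, and adjacency to `n - 2` forces `2` or `4`.
  have pn2 := h.pos _ gn2.1
  have hf1 := mem_setA.1 (h.mem 1 hone)
  have hs1 : 1 + g (n - 1) ∈ L := by
    have e : 1 + g (n - 1) = g n := by omega
    exact e ▸ gn.1
  rw [h.add_mem_iff _ hone _ gn1.1 (by omega), gn1.2, mem_setA] at hs1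
  have hs2 : 1 + g (n - 2) ∈ L := by
    have e : 1 + g (n - 2) = g (n - 1) := by omega
    exact e ▸ gn1.1
  have hne : 1 ≠ g (n - 2) := by
    intro e
    have := gn2.2
    rw [← e] at this
    omega
  rw [h.add_mem_iff _ hone _ gn2.1 hne, gn2.2, mem_setA] at hs2
  omega

theorem one_notMem (h : IsLabelSet n L f) (hn : 39 ≤ n) : 1 ∉ L := by
  have hg : ∃ g : ℕ → ℕ, ∀ i ∈ setA n, g i ∈ L ∧ f (g i) = i := by
    choose g hg using h.surj
    refine ⟨fun i => if hi : i ∈ setA n then g i hi else 0, fun i hi => ?_⟩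
    simpa [hi] using hg i hi
  obtain ⟨g, hg⟩ := hg
  rcases OffsetOrder.exists_chain (P := IsTop n L g) (fun _ hJ => hJ.1) (h.isTop_nil hn hg)
      (fun _ hT hJ => h.exists_isTop_cons hn hg hJ hT) with hT | hT
  · exact h.one_notMem_of_isTop hn hg hT
  · exact (h.not_isTop_without_two hn hg hT).elim

end IsLabelSet

/-! ### From sum labelings of blow-ups to label sets -/

theorem IsSumLabeling.comp_iso {V W : Type*} {G : SimpleGraph V} {H : SimpleGraph W} {l : V → ℕ}
    (hl : IsSumLabeling G l) (φ : H ≃g G) : IsSumLabeling H (l ∘ φ) where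
  pos x := hl.pos _
  adj_iff x y hxy := by
    rw [← φ.map_adj_iff, hl.adj_iff _ _ (φ.injective.ne hxy)]
    exact (φ.surjective.exists (p := fun z => l z = l (φ x) + l (φ y)))

section blowUp

variable {n : ℕ} {k : {i : ℕ // i ∈ setA n} → ℕ}

theorem blowUp_graphA_adj {u v : Σ x : {i : ℕ // i ∈ setA n}, Fin (k x)} :
    (blowUp (graphA n) k).Adj u v ↔ u ≠ v ∧ (u.1 : ℕ) + v.1 ∈ setA n :=
  Iff.rfl

theorem exists_vertex (hk : IsCliqueSize (graphA n) k) {i : ℕ} (hi : i ∈ setA n) :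
    ∃ v : Σ x : {i : ℕ // i ∈ setA n}, Fin (k x), (v.1 : ℕ) = i := by
  have h := hk ⟨i, hi⟩
  have : 0 < k ⟨i, hi⟩ := by
    by_cases hl : (graphA n).Adj ⟨i, hi⟩ ⟨i, hi⟩
    · have := h.1 hl
      omega
    · have := h.2 hl
      omega
  exact ⟨⟨⟨i, hi⟩, ⟨0, this⟩⟩, rfl⟩

theorem exists_twin (hk : IsCliqueSize (graphA n) k) (u : Σ x : {i : ℕ // i ∈ setA n}, Fin (k x))
    (hu : (u.1 : ℕ) + u.1 ∈ setA n) : ∃ v, v ≠ u ∧ v.1 = u.1 := by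
  obtain ⟨x, y⟩ := u
  have h2 : 2 ≤ k x := (hk x).1 hu
  have : Nontrivial (Fin (k x)) := Fin.nontrivial_iff_two_le.2 h2
  obtain ⟨z, hz⟩ := exists_ne y
  exact ⟨⟨x, z⟩, fun e => hz (by simpa using e), rfl⟩

theorem isSumLabeling_blowUp (hk : IsCliqueSize (graphA n) k) :
    IsSumLabeling (blowUp (graphA n) k) fun v => (v.1 : ℕ) where
  pos v := by
    have := mem_setA.1 v.1.2
    omega
  adj_iff u v huv := by
    rw [blowUp_graphA_adj, and_iff_right huv]
    exact ⟨exists_vertex hk, fun ⟨z, hz⟩ => hz ▸ z.1.2⟩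

variable {l : (Σ x : {i : ℕ // i ∈ setA n}, Fin (k x)) → ℕ}

/-- Adjacency to a third vertex depends only on the label. -/
theorem add_mem_iff_of_label_eq (hl : IsSumLabeling (blowUp (graphA n) k) l)
    {u v w : Σ x : {i : ℕ // i ∈ setA n}, Fin (k x)} (h : l u = l v) (hu : w ≠ u) (hv : w ≠ v) :
    (w.1 : ℕ) + u.1 ∈ setA n ↔ (w.1 : ℕ) + v.1 ∈ setA n := by
  have h1 := hl.adj_iff w u hu
  have h2 := hl.adj_iff w v hv
  rw [blowUp_graphA_adj, and_iff_right hu] at h1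
  rw [blowUp_graphA_adj, and_iff_right hv] at h2
  rw [h1, h2, h]

theorem not_lt_of_label_eq (hn : 39 ≤ n) (hk : IsCliqueSize (graphA n) k)
    (hl : IsSumLabeling (blowUp (graphA n) k) l) {u v : Σ x : {i : ℕ // i ∈ setA n}, Fin (k x)}
    (h : l u = l v) : ¬ (u.1 : ℕ) < v.1 := by
  intro hlt
  have hu := mem_setA.1 u.1.2
  have hv := mem_setA.1 v.1.2
  have key : ∀ p ∈ setA n, p ≠ u.1 → p ≠ v.1 → (p + u.1 ∈ setA n ↔ p + v.1 ∈ setA n) := by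
    intro p hp hpu hpv
    obtain ⟨w, rfl⟩ := exists_vertex hk hp
    exact add_mem_iff_of_label_eq hl h (fun e => hpu (by rw [e])) (fun e => hpv (by rw [e]))
  simp only [mem_setA] at key
  rcases eq_or_ne (n + 2) (u.1 + u.1) with he | he
  -- A twin of `u` is adjacent to `u`, but its sum with the larger class of `v` exceeds `n + 2`.
  · obtain ⟨w, hw, hw'⟩ := exists_twin hk u (mem_setA.2 (by omega))
    have := add_mem_iff_of_label_eq hl h hw (by rintro rfl; rw [hw'] at hlt; omega)
    rw [hw', mem_setA, mem_setA] at this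
    omega
  -- The class `n + 2 - u` separates `u` from `v` unless it is `v` itself. Then `u - 1` does,
  -- because its sum with `v` is the missing `n + 1`; for `u = 2`, `v = n` the separating class is
  -- `3`.
  · have h1 := key (n + 2 - u.1)
    have h2 := key (u.1 - 1)
    have h3 := key 3
    omega

theorem class_eq_of_label_eq (hn : 39 ≤ n) (hk : IsCliqueSize (graphA n) k)
    (hl : IsSumLabeling (blowUp (graphA n) k) l) {u v : Σ x : {i : ℕ // i ∈ setA n}, Fin (k x)}
    (h : l u = l v) : (u.1 : ℕ) = v.1 := by
  have h1 := not_lt_of_label_eq hn hk hl h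
  have h2 := not_lt_of_label_eq hn hk hl h.symm
  omega

theorem exists_isLabelSet (hn : 39 ≤ n) (hk : IsCliqueSize (graphA n) k)
    (hl : IsSumLabeling (blowUp (graphA n) k) l) :
    ∃ f, IsLabelSet n (Finset.univ.image l) f := by
  obtain ⟨f, hf⟩ : ∃ f : ℕ → ℕ, ∀ v, f (l v) = v.1 := by
    classical
    refine ⟨fun m => if h : ∃ v, l v = m then (h.choose.1 : ℕ) else 0, fun v => ?_⟩
    have h : ∃ u, l u = l v := ⟨v, rfl⟩
    simp only [dif_pos h]
    exact class_eq_of_label_eq hn hk hl h.choose_spec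
  refine ⟨f, ?_, ?_, ?_, ?_, ?_, ?_⟩
  · intro m hm
    obtain ⟨v, -, rfl⟩ := Finset.mem_image.1 hm
    exact hl.pos v
  · simp only [Finset.mem_image, Finset.mem_univ, true_and, forall_exists_index,
      forall_apply_eq_imp_iff, hf]
    exact fun v => v.1.2
  · intro i hi
    obtain ⟨v, rfl⟩ := exists_vertex hk hi
    exact ⟨l v, Finset.mem_image_of_mem _ (Finset.mem_univ _), hf v⟩
  · simp only [Finset.mem_image, Finset.mem_univ, true_and, forall_exists_index,
      forall_apply_eq_imp_iff, hf]
    intro u v huv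
    have hne : u ≠ v := fun e => huv (by rw [e])
    rw [← hl.adj_iff u v hne, blowUp_graphA_adj, and_iff_right hne]
  · simp only [Finset.mem_image, Finset.mem_univ, true_and, forall_exists_index,
      forall_apply_eq_imp_iff, hf]
    rintro ⟨x, i⟩ ⟨y, j⟩ hxy hx
    obtain rfl : x = y := Subtype.ext hxy
    have h1 : k x = 1 := (hk x).2 hx
    have : i = j := Fin.ext (by omega)
    rw [this]
  · simp only [Finset.mem_image, Finset.mem_univ, true_and, forall_exists_index,
      forall_apply_eq_imp_iff, hf]
    intro u hu
    obtain ⟨v, hvu, hv⟩ := exists_twin hk u hu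
    -- Twins with a common label are adjacent, which makes twice that label a label.
    by_cases he : l v = l u
    · left
      have := (hl.adj_iff v u hvu).1 ⟨hvu, by rw [hv]; exact hu⟩
      rwa [he] at this
    · exact Or.inr ⟨l v, ⟨v, rfl⟩, he, by rw [hf, hv]⟩

end blowUp

theorem isNonInjSumGraph_of_inC {n : ℕ} {W : Type*} {H : SimpleGraph W} (h : InC (graphA n) H) :
    IsNonInjSumGraph H := by
  obtain ⟨k, hk, ⟨φ⟩⟩ := h
  exact ⟨_, (isSumLabeling_blowUp hk).comp_iso φ⟩

theorem not_isMinimalLabeling_of_inC {n : ℕ} (hn : 39 ≤ n) {W : Type*} {H : SimpleGraph W}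
    (h : InC (graphA n) H) (l : W → ℕ) : ¬ IsMinimalLabeling H l := by
  obtain ⟨k, hk, ⟨φ⟩⟩ := h
  rintro ⟨hl, x, hx⟩
  obtain ⟨f, hf⟩ := exists_isLabelSet hn hk (hl.comp_iso φ.symm)
  refine hf.one_notMem hn (Finset.mem_image.2 ⟨φ x, Finset.mem_univ _, ?_⟩)
  simpa using hx

/-! ### Pairwise non-isomorphic members -/

/-- Clique sizes with `n ^ 2` copies of the vertex `2` and `2` copies of every other looped
vertex. -/
def cliqueSize (n : ℕ) (x : {i : ℕ // i ∈ setA n}) : ℕ :=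
  if (x : ℕ) = 2 then n ^ 2 else if (x : ℕ) + x ∈ setA n then 2 else 1

theorem isCliqueSize_cliqueSize {n : ℕ} (hn : 4 ≤ n) :
    IsCliqueSize (graphA n) (cliqueSize n) := by
  intro x
  have hadj : (graphA n).Adj x x ↔ (x : ℕ) + x ∈ setA n := Iff.rfl
  rw [hadj]
  unfold cliqueSize
  split_ifs with h2 hx
  · rw [h2, mem_setA]
    refine ⟨fun _ => by nlinarith, fun h => (h (by omega)).elim⟩
  · simp [hx]
  · simp [hx]

/-- The `n ^ 2` copies of `2` dominate: all `n` classes together add at most `2 * n` vertices. The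
orders for different `n` thus lie in disjoint intervals between consecutive squares. -/
theorem card_blowUp_cliqueSize {n : ℕ} (hn : 2 ≤ n) :
    n ^ 2 ≤ Fintype.card (Σ x, Fin (cliqueSize n x)) ∧
      Fintype.card (Σ x, Fin (cliqueSize n x)) < (n + 1) ^ 2 := by
  have h2 : 2 ∈ setA n := mem_setA.2 (by omega)
  simp only [Fintype.card_sigma, Fintype.card_fin]
  constructor
  · calc n ^ 2 = cliqueSize n ⟨2, h2⟩ := by simp [cliqueSize]
      _ ≤ _ := Finset.single_le_sum (f := cliqueSize n) (fun _ _ => Nat.zero_le _)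
        (Finset.mem_univ _)
  · have hcard : (setA n).card = n := by
      rw [setA, Finset.card_insert_of_notMem (by simp), Nat.card_Icc]
      omega
    calc ∑ x, cliqueSize n x
        ≤ ∑ x, ((if x = (⟨2, h2⟩ : {i : ℕ // i ∈ setA n}) then n ^ 2 else 0) + 2) := by
          refine Finset.sum_le_sum fun x _ => ?_
          have hx : x = ⟨2, h2⟩ ↔ (x : ℕ) = 2 := Subtype.ext_iff
          simp only [cliqueSize, hx]
          split_ifs <;> omega
      _ = n ^ 2 + n * 2 := by simp [Finset.sum_add_distrib, hcard]
      _ < (n + 1) ^ 2 := by nlinarith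

theorem isEmpty_iso_blowUp_cliqueSize {m n : ℕ} (hm : 2 ≤ m) (hmn : m < n) :
    IsEmpty (blowUp (graphA m) (cliqueSize m) ≃g blowUp (graphA n) (cliqueSize n)) := by
  refine ⟨fun φ => ?_⟩
  have hc := Fintype.card_congr φ.toEquiv
  have h1 := (card_blowUp_cliqueSize hm).2
  have h2 := (card_blowUp_cliqueSize (n := n) (by omega)).1
  have h3 : (m + 1) ^ 2 ≤ n ^ 2 := Nat.pow_le_pow_left hmn 2
  omega

end SumGraphs

theorem theorem2 :
    (∀ n : ℕ, 39 ≤ n → ∀ (W : Type*) (H : SimpleGraph W),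
      SumGraphs.InC (SumGraphs.graphA n) H →
        SumGraphs.IsNonInjSumGraph H ∧ ¬ ∃ l : W → ℕ, SumGraphs.IsMinimalLabeling H l) ∧
    (∃ (V : ℕ → Type) (F : ∀ i, SimpleGraph (V i)),
      (∀ i j, i ≠ j → IsEmpty (F i ≃g F j)) ∧
      ∀ i, Finite (V i) ∧
        SumGraphs.InC (SumGraphs.graphA (39 + i)) (F i) ∧
        SumGraphs.IsNonInjSumGraph (F i) ∧
        ¬ ∃ l : V i → ℕ, SumGraphs.IsMinimalLabeling (F i) l) := by
  refine ⟨fun n hn W H h => ⟨SumGraphs.isNonInjSumGraph_of_inC h, fun ⟨l, hl⟩ =>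
    SumGraphs.not_isMinimalLabeling_of_inC hn h l hl⟩,
    fun i => Σ x, Fin (SumGraphs.cliqueSize (39 + i) x),
    fun i => SumGraphs.blowUp (SumGraphs.graphA (39 + i)) (SumGraphs.cliqueSize (39 + i)),
    fun i j hij => ?_, fun i => ?_⟩
  · rcases hij.lt_or_gt with h | h
    · exact SumGraphs.isEmpty_iso_blowUp_cliqueSize (by omega) (by omega)
    · have := SumGraphs.isEmpty_iso_blowUp_cliqueSize (m := 39 + j) (n := 39 + i) (by omega)
        (by omega)
      exact ⟨fun φ => this.false φ.symm⟩
  · have hC : SumGraphs.InC (SumGraphs.graphA (39 + i))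
        (SumGraphs.blowUp (SumGraphs.graphA (39 + i)) (SumGraphs.cliqueSize (39 + i))) :=
      ⟨_, SumGraphs.isCliqueSize_cliqueSize (by omega), ⟨SimpleGraph.Iso.refl⟩⟩
    exact ⟨inferInstance, hC, SumGraphs.isNonInjSumGraph_of_inC hC, fun ⟨l, hl⟩ =>
      SumGraphs.not_isMinimalLabeling_of_inC (by omega) hC l hl⟩
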